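/- Let $G$ be a finite simple graph with vertex set $V$, and let $\mathbf{k}$ be a field. Let $\operatorname{ind}(G)$ be the independence complex of $G$, i.e. the simplicial complex on $V$ whose faces are the sets of pairwise non-adjacent vertices, and let $\tilde H_k(\operatorname{ind}(G);\mathbf{k})$ be its reduced simplicial homology ($k\in\mathbb{Z}$; the empty set is a face of dimension $-1$). A set $F$ of edges of $G$ is called edgewise dominant if every vertex of $G$ is adjacent to an endpoint of some edge in $F$. Put $$\epsilon(G)=\min\{|F| : F \text{ is an edgewise dominant set of edges of } G\},$$ $$\gamma_0(G)=\min\{|A| : A\subseteq V,\ \text{every vertex of } G \text{ is adjacent to some } a\in A\},$$ where the minimum of the empty set is $\infty$ (this occurs exactly when $G$ has an isolated vertex). Then 1. $\tilde H_k(\operatorname{ind}(G);\mathbf{k})=0$ for every integer $k<\epsilon(G)-1$; 2. (Chudnovsky's bound) $\tilde H_k(\operatorname{ind}(G);\mathbf{k})=0$ for every integer $k<\frac{\gamma_0(G)}{2}-1$. -/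

import Mathlib

open scoped ENNReal

noncomputable section

/-! ### Reduced simplicial homology -/

namespace ReducedHomology

/-- The sign exponent of `v` in `s`: the number of elements of `s` that precede `v`.  If
`s = {v₀ < v₁ < ⋯ < vₙ}`, then `pos s (vᵢ) = i`. -/
def pos {V : Type*} [LinearOrder V] (s : Finset V) (v : V) : ℕ :=
  (s.filter (fun w => w < v)).card

/-- The simplicial boundary operator (on the full simplex with vertex set `V`, including the empty
face), determined by `∂ {v₀ < ⋯ < vₙ} = ∑ i, (-1) ^ i • {v₀, …, vᵢ₋₁, vᵢ₊₁, …, vₙ}`.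
In particular `∂ {v} = ∅` (the augmentation) and `∂ ∅ = 0`. -/
def boundary (R : Type*) [CommRing R] (V : Type*) [LinearOrder V] :
    (Finset V →₀ R) →ₗ[R] (Finset V →₀ R) :=
  Finsupp.lsum R fun s : Finset V =>
    ∑ v ∈ s, ((-1 : R) ^ pos s v) • Finsupp.lsingle (s.erase v)

/-- The `k`-th module of the augmented simplicial chain complex of `K` with coefficients in `R`:
the free module on the faces with exactly `k + 1` vertices.  The empty set is the unique face of
dimension `-1`; it has to be added since Mathlib only lists the nonempty faces of a complex. -/
def chains (R : Type*) [CommRing R] {V : Type*} (K : AbstractSimplicialComplex V) (k : ℤ) :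
    Submodule R (Finset V →₀ R) :=
  Finsupp.supported R R {s : Finset V | (s = ∅ ∨ s ∈ K.faces) ∧ (s.card : ℤ) = k + 1}

/-- The reduced `k`-cycles of `K`. -/
def cycles (R : Type*) [CommRing R] {V : Type*} [LinearOrder V]
    (K : AbstractSimplicialComplex V) (k : ℤ) : Submodule R (Finset V →₀ R) :=
  chains R K k ⊓ LinearMap.ker (boundary R V)

/-- The reduced `k`-boundaries of `K`. -/
def boundaries (R : Type*) [CommRing R] {V : Type*} [LinearOrder V]
    (K : AbstractSimplicialComplex V) (k : ℤ) : Submodule R (Finset V →₀ R) :=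
  (chains R K (k + 1)).map (boundary R V)

lemma boundary_single {R : Type*} [CommRing R] {V : Type*} [LinearOrder V] (s : Finset V) (r : R) :
    boundary R V (Finsupp.single s r)
      = ∑ v ∈ s, Finsupp.single (s.erase v) ((-1 : R) ^ pos s v * r) := by
  simp [boundary]

lemma boundary_boundary {R : Type*} [CommRing R] {V : Type*} [LinearOrder V] (x : Finset V →₀ R) :
    boundary R V (boundary R V x) = 0 := by
  induction x using Finsupp.induction_linear with
  | zero => simp
  | add f g hf hg => simp [hf, hg]
  | single s r =>
    simp only [boundary_single, map_sum]
    rw [Finset.sum_sigma']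
    refine Finset.sum_involution (fun p _ => ⟨p.2, p.1⟩) ?_ ?_ ?_ ?_
    · rintro ⟨v, w⟩ h
      simp only [Finset.mem_sigma, Finset.mem_erase] at h
      obtain ⟨hv, hwv, hw⟩ := h
      have key : ∀ a b : V, a ∈ s → b ∈ s → a < b →
          Finsupp.single ((s.erase a).erase b) ((-1 : R) ^ pos (s.erase a) b * ((-1) ^ pos s a * r))
          + Finsupp.single ((s.erase b).erase a)
            ((-1 : R) ^ pos (s.erase b) a * ((-1) ^ pos s b * r)) = 0 := by
        intro a b ha hb hab
        have h1 : pos (s.erase b) a = pos s a := by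
          unfold pos
          congr 1
          ext x
          simp only [Finset.mem_filter, Finset.mem_erase]
          constructor
          · rintro ⟨⟨_, h⟩, h'⟩
            exact ⟨h, h'⟩
          · rintro ⟨h, h'⟩
            exact ⟨⟨(h'.trans hab).ne, h⟩, h'⟩
        have h2 : pos s b = pos (s.erase a) b + 1 := by
          unfold pos
          rw [Finset.filter_erase, Finset.card_erase_add_one]
          simp [ha, hab]
        rw [Finset.erase_right_comm, ← Finsupp.single_add, h1, h2]
        rw [show (-1 : R) ^ pos (s.erase a) b * ((-1) ^ pos s a * r)
          + (-1) ^ pos s a * ((-1) ^ (pos (s.erase a) b + 1) * r) = 0 by ring]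
        simp
      rcases lt_or_gt_of_ne hwv with h | h
      · rw [add_comm]
        exact key w v hw hv h
      · exact key v w hv hw h
    · rintro ⟨v, w⟩ h _ heq
      simp only [Finset.mem_sigma, Finset.mem_erase] at h
      simp only [Sigma.mk.injEq] at heq
      exact h.2.1 heq.1
    · rintro ⟨v, w⟩ h
      simp only [Finset.mem_sigma, Finset.mem_erase] at h ⊢
      exact ⟨h.2.2, h.2.1.symm, h.1⟩
    · rintro ⟨v, w⟩ _
      rfl

lemma boundary_mem_chains {R : Type*} [CommRing R] {V : Type*} [LinearOrder V]
    (K : AbstractSimplicialComplex V) (k : ℤ) {x : Finset V →₀ R} (hx : x ∈ chains R K (k + 1)) :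
    boundary R V x ∈ chains R K k := by
  rw [← Finsupp.sum_single x, Finsupp.sum, map_sum]
  refine Submodule.sum_mem _ fun s hs => ?_
  obtain ⟨hface, hcard⟩ := hx hs
  rw [boundary_single]
  refine Submodule.sum_mem _ fun v hv => Finsupp.single_mem_supported R _ ⟨?_, ?_⟩
  · rcases (s.erase v).eq_empty_or_nonempty with h | h
    · exact Or.inl h
    · rcases hface with rfl | hface
      · simp at hv
      · exact Or.inr ((K.isRelLowerSet_faces hface).2 (Finset.erase_subset v s) h)
  · have := Finset.card_erase_add_one hv
    omega

/-- Every boundary is a cycle. -/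
lemma boundaries_le_cycles (R : Type*) [CommRing R] {V : Type*} [LinearOrder V]
    (K : AbstractSimplicialComplex V) (k : ℤ) : boundaries R K k ≤ cycles R K k := by
  rintro _ ⟨x, hx, rfl⟩
  exact ⟨boundary_mem_chains K k hx, boundary_boundary x⟩

/-- The quotient module `Z / B` of submodules `B ≤ Z` of a module `M`. -/
abbrev Subquotient {R M : Type*} [Ring R] [AddCommGroup M] [Module R M] (Z B : Submodule R M) :
    Type _ :=
  Z ⧸ B.submoduleOf Z

/-- The `k`-th reduced simplicial homology module `H̃ₖ(K; R)`: reduced `k`-cycles modulo reduced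
`k`-boundaries. -/
def homology (R : Type*) [CommRing R] {V : Type*} [LinearOrder V]
    (K : AbstractSimplicialComplex V) (k : ℤ) : Type _ :=
  Subquotient (cycles R K k) (boundaries R K k)

instance (R : Type*) [CommRing R] {V : Type*} [LinearOrder V]
    (K : AbstractSimplicialComplex V) (k : ℤ) : AddCommGroup (homology R K k) :=
  Submodule.Quotient.addCommGroup _

instance (R : Type*) [CommRing R] {V : Type*} [LinearOrder V]
    (K : AbstractSimplicialComplex V) (k : ℤ) : Module R (homology R K k) :=
  Submodule.Quotient.module _

end ReducedHomology

/-! ### Independence complex and domination parameters of a graph -/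

namespace SimpleGraph

/-- The independence complex `ind(G)`: its (nonempty) faces are the nonempty independent sets of
vertices of `G`. -/
def indComplex {V : Type*} (G : SimpleGraph V) : AbstractSimplicialComplex V where
  faces := {s : Finset V | s.Nonempty ∧ G.IsIndepSet (s : Set V)}
  isRelLowerSet_faces := fun _ hs =>
    ⟨hs.1, fun _ hts ht => ⟨ht, Set.Pairwise.mono (Finset.coe_subset.mpr hts) hs.2⟩⟩
  singleton_mem := fun v => ⟨Finset.singleton_nonempty v, by simp [SimpleGraph.IsIndepSet]⟩

/-- A set `F` of edges of `G` is edgewise dominant if every vertex of `G` is adjacent to an endpoint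
of some edge in `F`. -/
def IsEdgewiseDominant {V : Type*} (G : SimpleGraph V) (F : Finset (Sym2 V)) : Prop :=
  (F : Set (Sym2 V)) ⊆ G.edgeSet ∧ ∀ v : V, ∃ e ∈ F, ∃ w ∈ e, G.Adj v w

/-- `ε(G)`: the least cardinality of an edgewise dominant set of edges of `G`.  It is `⊤`
if there is no such set (for finite `G`: if `G` has an isolated vertex). -/
def edgewiseDominationNumber {V : Type*} (G : SimpleGraph V) : ℕ∞ :=
  ⨅ (F : Finset (Sym2 V)) (_ : G.IsEdgewiseDominant F), (F.card : ℕ∞)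

/-- `γ₀(X, G)`: the least cardinality of a set `A` of vertices of `G` such that every vertex in `X`
is adjacent to some `a ∈ A`.  It is `⊤` if there is no such set. -/
def gammaZeroOf {V : Type*} (G : SimpleGraph V) (X : Set V) : ℕ∞ :=
  ⨅ (A : Finset V) (_ : ∀ x ∈ X, ∃ a ∈ A, G.Adj a x), (A.card : ℕ∞)

/-- `γ₀(G) = γ₀(V(G), G)`: the least cardinality of a set `A` of vertices such that every vertex of
`G` (also those in `A`) is adjacent to some `a ∈ A`. -/
def gammaZero {V : Type*} (G : SimpleGraph V) : ℕ∞ :=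
  G.gammaZeroOf Set.univ

end SimpleGraph

end

/-! Let `W` be a set of vertices not dominated by `n` edges of `G`. By induction on `n`, and for
fixed `n` on the number of edges of `G`, every cycle `x` on independent `n`-subsets of `W` bounds
inside `W`; `W` is the whole vertex set in the application. Faces are confined to `W`, while
dominating edges may be any edges of `G`. If `W` spans no edge, its independent sets form a simplex,
which is a cone. Otherwise delete an edge `uv` inside `W`. Domination only gets harder, so `x = ∂y`
in the larger complex. The part of `y` on faces containing both `u` and `v` is `u ∧ v ∧ z`, with `z`
a cycle on common non-neighbours of `u` and `v` in `W`. One edge fewer cannot dominate these, since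
adding `uv` would dominate `W`; so `z = ∂w`. Then `y - ∂(u ∧ v ∧ w)` still fills `x` and uses no
face containing `uv`. This is `exists_boundary_eq_of_deleteEdges`. Chudnovsky's bound follows
because the endpoints of an edgewise dominant set `F` give `γ₀ ≤ 2|F|`. -/

noncomputable section

/-! ### Exterior calculus on chains: cone, contraction, boundary -/

namespace ReducedHomology

variable {R : Type*} [CommRing R] {V : Type*} [LinearOrder V]

/-- Removing the smaller vertex first lowers the position of the larger by one; the other order
shifts nothing. -/
lemma neg_one_pow_pos_mul_erase {s : Finset V} {a b : V} (ha : a ∈ s) (hb : b ∈ s) (hab : a ≠ b) :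
    (-1 : R) ^ pos s a * (-1) ^ pos (s.erase a) b
      = -((-1 : R) ^ pos s b * (-1) ^ pos (s.erase b) a) := by
  have key : ∀ a b : V, a ∈ s → b ∈ s → a < b →
      pos (s.erase b) a = pos s a ∧ pos s b = pos (s.erase a) b + 1 := by
    intro a b ha hb hab
    constructor
    · unfold pos
      congr 1
      ext x
      simp only [Finset.mem_filter, Finset.mem_erase]
      constructor
      · rintro ⟨⟨_, h⟩, h'⟩
        exact ⟨h, h'⟩
      · rintro ⟨h, h'⟩
        exact ⟨⟨(h'.trans hab).ne, h⟩, h'⟩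
    · unfold pos
      rw [Finset.filter_erase, Finset.card_erase_add_one]
      simp [ha, hab]
  rcases lt_or_gt_of_ne hab with h | h
  · obtain ⟨h1, h2⟩ := key a b ha hb h
    rw [h1, h2]
    ring
  · obtain ⟨h1, h2⟩ := key b a hb ha h
    rw [h1, h2]
    ring

lemma pos_insert_self (s : Finset V) (v : V) : pos (insert v s) v = pos s v := by
  simp [pos, Finset.filter_insert]

lemma pos_erase_self (s : Finset V) (v : V) : pos (s.erase v) v = pos s v := by
  unfold pos
  congr 1
  ext x
  simp only [Finset.mem_filter, Finset.mem_erase]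
  exact ⟨fun h => ⟨h.1.2, h.2⟩, fun h => ⟨⟨h.2.ne, h.1⟩, h.2⟩⟩

lemma neg_one_pow_mul_self (n : ℕ) : (-1 : R) ^ n * (-1) ^ n = 1 := by
  rw [← mul_pow]
  simp

/-- The cone operator with apex `v`: the exterior product with `v` on the left. -/
def cone (R : Type*) [CommRing R] {V : Type*} [LinearOrder V] (v : V) :
    (Finset V →₀ R) →ₗ[R] (Finset V →₀ R) :=
  Finsupp.lsum R fun s : Finset V =>
    if v ∈ s then 0 else ((-1 : R) ^ pos s v) • Finsupp.lsingle (insert v s)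

/-- The contraction with `v`, which sends a face containing `v` to the opposite face of its link,
up to sign, and every other face to `0`. -/
def contract (R : Type*) [CommRing R] {V : Type*} [LinearOrder V] (v : V) :
    (Finset V →₀ R) →ₗ[R] (Finset V →₀ R) :=
  Finsupp.lsum R fun s : Finset V =>
    if v ∈ s then ((-1 : R) ^ pos s v) • Finsupp.lsingle (s.erase v) else 0

lemma cone_single_of_mem {v : V} {s : Finset V} (h : v ∈ s) (r : R) :
    cone R v (Finsupp.single s r) = 0 := by
  simp [cone, h]

lemma cone_single_of_notMem {v : V} {s : Finset V} (h : v ∉ s) (r : R) :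
    cone R v (Finsupp.single s r) = Finsupp.single (insert v s) ((-1 : R) ^ pos s v * r) := by
  simp [cone, h]

lemma contract_single_of_mem {v : V} {s : Finset V} (h : v ∈ s) (r : R) :
    contract R v (Finsupp.single s r) = Finsupp.single (s.erase v) ((-1 : R) ^ pos s v * r) := by
  simp [contract, h]

lemma contract_single_of_notMem {v : V} {s : Finset V} (h : v ∉ s) (r : R) :
    contract R v (Finsupp.single s r) = 0 := by
  simp [contract, h]

/-- The Leibniz rule `∂(v ∧ x) = x - v ∧ ∂x`: coning is a contracting homotopy of the full simplex.
-/
lemma boundary_cone_add_cone_boundary (v : V) (x : Finset V →₀ R) :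
    boundary R V (cone R v x) + cone R v (boundary R V x) = x := by
  induction x using Finsupp.induction_linear with
  | zero => simp
  | add f g hf hg =>
    simp only [map_add]
    rw [add_add_add_comm, hf, hg]
  | single s r =>
    by_cases hv : v ∈ s
    · rw [cone_single_of_mem hv, boundary_single, map_zero, zero_add, map_sum,
        Finset.sum_eq_single v]
      · rw [cone_single_of_notMem (Finset.notMem_erase v s), Finset.insert_erase hv, pos_erase_self,
          ← mul_assoc, neg_one_pow_mul_self, one_mul]
      · intro w _ hw
        exact cone_single_of_mem (Finset.mem_erase.2 ⟨hw.symm, hv⟩) _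
      · exact fun h => absurd hv h
    · rw [cone_single_of_notMem hv, boundary_single, boundary_single, map_sum,
        Finset.sum_insert hv, Finset.erase_insert hv, pos_insert_self, ← mul_assoc,
        neg_one_pow_mul_self, one_mul, add_assoc, ← Finset.sum_add_distrib,
        Finset.sum_eq_zero, add_zero]
      intro w hw
      have hvw : v ≠ w := fun h => hv (h ▸ hw)
      have hv' : v ∉ s.erase w := fun h => hv (Finset.mem_of_mem_erase h)
      have sign := neg_one_pow_pos_mul_erase (R := R) (Finset.mem_insert_self v s)
        (Finset.mem_insert_of_mem hw) hvw
      rw [Finset.erase_insert hv, Finset.erase_insert_of_ne hvw, pos_insert_self,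
        pos_insert_self] at sign
      rw [cone_single_of_notMem hv', Finset.erase_insert_of_ne hvw, ← Finsupp.single_add,
        ← Finsupp.single_zero (insert v (s.erase w))]
      congr 1
      have ha := neg_one_pow_mul_self (R := R) (pos (insert v s) w)
      have hd := neg_one_pow_mul_self (R := R) (pos s w)
      generalize (-1 : R) ^ pos (insert v s) w = a at *
      generalize (-1 : R) ^ pos (s.erase w) v = b at *
      generalize (-1 : R) ^ pos s v = c at *
      generalize (-1 : R) ^ pos s w = d at *
      -- Here `sign` reads `cd = -ab`; multiplying by `ad` and using `a² = d² = 1` gives `ac = -bd`.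
      linear_combination (r * a * d) * sign - r * a * c * hd - r * b * d * ha

/-- Both operators are contractions of the exterior algebra, by the dual vector of `v` and by the
sum of all dual vectors, so they anticommute. -/
lemma contract_boundary (v : V) (x : Finset V →₀ R) :
    contract R v (boundary R V x) = -boundary R V (contract R v x) := by
  induction x using Finsupp.induction_linear with
  | zero => simp
  | add f g hf hg =>
    simp only [map_add, hf, hg]
    rw [neg_add]
  | single s r =>
    by_cases hv : v ∈ s
    · rw [contract_single_of_mem hv, boundary_single, boundary_single, map_sum,
        ← Finset.add_sum_erase _ _ hv, contract_single_of_notMem (Finset.notMem_erase v s),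
        zero_add, ← Finset.sum_neg_distrib]
      refine Finset.sum_congr rfl fun w hw => ?_
      obtain ⟨hwv, hw⟩ := Finset.mem_erase.1 hw
      rw [contract_single_of_mem (Finset.mem_erase.2 ⟨hwv.symm, hv⟩), Finset.erase_right_comm,
        ← Finsupp.single_neg]
      congr 1
      linear_combination r * neg_one_pow_pos_mul_erase (R := R) hw hv hwv
    · rw [contract_single_of_notMem hv, boundary_single, map_sum, map_zero, neg_zero]
      exact Finset.sum_eq_zero fun w _ =>
        contract_single_of_notMem (fun h => hv (Finset.mem_of_mem_erase h)) _

lemma contract_cone_of_supported {v : V} {x : Finset V →₀ R}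
    (hx : x ∈ Finsupp.supported R R {s : Finset V | v ∉ s}) :
    contract R v (cone R v x) = x := by
  conv_rhs => rw [← Finsupp.sum_single x]
  conv_lhs => rw [← Finsupp.sum_single x]
  simp only [Finsupp.sum, map_sum]
  refine Finset.sum_congr rfl fun s hs => ?_
  have hv : v ∉ s := hx hs
  rw [cone_single_of_notMem hv, contract_single_of_mem (Finset.mem_insert_self v s),
    Finset.erase_insert hv, pos_insert_self, ← mul_assoc, neg_one_pow_mul_self, one_mul]

lemma mem_supported_of_forall_mem {α M : Type*} [AddCommMonoid M] [Module R M] {S T : Set α}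
    {x : α →₀ M} (hx : x ∈ Finsupp.supported M R S) (h : ∀ s ∈ S, s ∈ T) :
    x ∈ Finsupp.supported M R T :=
  Finsupp.supported_mono h hx

lemma map_mem_supported {α : Type*} {S T : Set α} (f : (α →₀ R) →ₗ[R] (α →₀ R))
    (hf : ∀ s ∈ S, ∀ r : R, f (Finsupp.single s r) ∈ Finsupp.supported R R T)
    {x : α →₀ R} (hx : x ∈ Finsupp.supported R R S) :
    f x ∈ Finsupp.supported R R T := by
  rw [← Finsupp.sum_single x, Finsupp.sum, map_sum]
  exact Submodule.sum_mem _ fun s hs => hf s (hx hs) _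

lemma cone_mem_supported {S T : Set (Finset V)} {v : V}
    {x : Finset V →₀ R} (hx : x ∈ Finsupp.supported R R S)
    (h : ∀ s ∈ S, v ∉ s → insert v s ∈ T) : cone R v x ∈ Finsupp.supported R R T := by
  refine map_mem_supported _ (fun s hs r => ?_) hx
  by_cases hv : v ∈ s
  · rw [cone_single_of_mem hv]
    exact Submodule.zero_mem _
  · rw [cone_single_of_notMem hv]
    exact Finsupp.single_mem_supported R _ (h s hs hv)

lemma contract_mem_supported {S T : Set (Finset V)} {v : V}
    {x : Finset V →₀ R} (hx : x ∈ Finsupp.supported R R S)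
    (h : ∀ s ∈ S, v ∈ s → s.erase v ∈ T) : contract R v x ∈ Finsupp.supported R R T := by
  refine map_mem_supported _ (fun s hs r => ?_) hx
  by_cases hv : v ∈ s
  · rw [contract_single_of_mem hv]
    exact Finsupp.single_mem_supported R _ (h s hs hv)
  · rw [contract_single_of_notMem hv]
    exact Submodule.zero_mem _

lemma boundary_mem_supported {S T : Set (Finset V)}
    {x : Finset V →₀ R} (hx : x ∈ Finsupp.supported R R S)
    (h : ∀ s ∈ S, ∀ v ∈ s, s.erase v ∈ T) : boundary R V x ∈ Finsupp.supported R R T := by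
  refine map_mem_supported _ (fun s hs r => ?_) hx
  rw [boundary_single]
  exact Submodule.sum_mem _ fun v hv => Finsupp.single_mem_supported R _ (h s hs v hv)

lemma contract_apply_erase {v : V} {s : Finset V} (hv : v ∈ s) (x : Finset V →₀ R) :
    contract R v x (s.erase v) = (-1 : R) ^ pos s v * x s := by
  induction x using Finsupp.induction_linear with
  | zero => simp
  | add f g hf hg => simp [hf, hg, mul_add]
  | single t r =>
    by_cases hvt : v ∈ t
    · rw [contract_single_of_mem hvt]
      by_cases h : t = s
      · subst h
        simp
      · have h' : t.erase v ≠ s.erase v := fun h' => h <| by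
          rw [← Finset.insert_erase hvt, h', Finset.insert_erase hv]
        simp [h, h']
    · have h : t ≠ s := fun h => hvt (h ▸ hv)
      simp [contract_single_of_notMem hvt, h]

lemma apply_eq_zero_of_contract_contract_eq_zero {u v : V} {s : Finset V} (huv : u ≠ v)
    (hu : u ∈ s) (hv : v ∈ s) {x : Finset V →₀ R} (h : contract R v (contract R u x) = 0) :
    x s = 0 := by
  have h1 := contract_apply_erase (Finset.mem_erase.2 ⟨huv.symm, hv⟩) (contract R u x)
  rw [h, contract_apply_erase hu] at h1
  have e1 := neg_one_pow_mul_self (R := R) (pos s u)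
  have e2 := neg_one_pow_mul_self (R := R) (pos (s.erase u) v)
  simp only [Finsupp.coe_zero, Pi.zero_apply] at h1
  calc x s = ((-1 : R) ^ pos s u * (-1) ^ pos s u) *
        ((-1) ^ pos (s.erase u) v * (-1) ^ pos (s.erase u) v) * x s := by rw [e1, e2]; ring
    _ = (-1) ^ pos s u * (-1) ^ pos (s.erase u) v *
        ((-1) ^ pos (s.erase u) v * ((-1) ^ pos s u * x s)) := by ring
    _ = 0 := by rw [← h1, mul_zero]

end ReducedHomology

/-! ### Edge domination and filling cycles of independent sets -/

namespace SimpleGraph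

open ReducedHomology

variable {V : Type*}

/-- The independent sets of `G` with exactly `n` vertices, all of them in `W`. -/
def indepSetsIn (G : SimpleGraph V) (W : Set V) (n : ℕ) : Set (Finset V) :=
  {s | (s : Set V) ⊆ W ∧ G.IsIndepSet (s : Set V) ∧ s.card = n}

/-- The set `F` of edges of `G` dominates `W` if every vertex in `W` is adjacent to an endpoint of
an edge in `F`. -/
def EdgesDominate (G : SimpleGraph V) (F : Finset (Sym2 V)) (W : Set V) : Prop :=
  (F : Set (Sym2 V)) ⊆ G.edgeSet ∧ ∀ v ∈ W, ∃ e ∈ F, ∃ w ∈ e, G.Adj v w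

lemma EdgesDominate.mono {G H : SimpleGraph V} (h : G ≤ H) {F : Finset (Sym2 V)} {W : Set V}
    (hF : G.EdgesDominate F W) : H.EdgesDominate F W :=
  ⟨hF.1.trans (edgeSet_mono h), fun v hv =>
    let ⟨e, he, w, hw, hvw⟩ := hF.2 v hv
    ⟨e, he, w, hw, h hvw⟩⟩

lemma EdgesDominate.insert [DecidableEq V] {G : SimpleGraph V} {F : Finset (Sym2 V)} {W : Set V}
    {u v : V} (huv : G.Adj u v)
    (hF : G.EdgesDominate F {w | w ∈ W ∧ ¬ G.Adj w u ∧ ¬ G.Adj w v}) :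
    G.EdgesDominate (insert s(u, v) F) W := by
  refine ⟨?_, fun w hw => ?_⟩
  · rw [Finset.coe_insert, Set.insert_subset_iff]
    exact ⟨huv, hF.1⟩
  · by_cases hwu : G.Adj w u
    · exact ⟨s(u, v), Finset.mem_insert_self _ _, u, Sym2.mem_mk_left u v, hwu⟩
    by_cases hwv : G.Adj w v
    · exact ⟨s(u, v), Finset.mem_insert_self _ _, v, Sym2.mem_mk_right u v, hwv⟩
    obtain ⟨e, he, h⟩ := hF.2 w ⟨hw, hwu, hwv⟩
    exact ⟨e, Finset.mem_insert_of_mem he, h⟩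

lemma IsIndepSet.of_deleteEdges {G : SimpleGraph V} {u v : V} {s : Set V}
    (hs : (G.deleteEdges {s(u, v)}).IsIndepSet s) (h : ¬ (u ∈ s ∧ v ∈ s)) : G.IsIndepSet s := by
  intro a ha b hb hab hadj
  refine hs ha hb hab ?_
  rw [deleteEdges_adj]
  refine ⟨hadj, fun he => ?_⟩
  rw [Set.mem_singleton_iff, Sym2.eq_iff] at he
  rcases he with ⟨rfl, rfl⟩ | ⟨rfl, rfl⟩
  · exact h ⟨ha, hb⟩
  · exact h ⟨hb, ha⟩

section LinearOrder

variable [LinearOrder V] {R : Type*} [CommRing R]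

/-- If `W` spans no edge, then a cycle of independent subsets of `W` is a boundary. -/
lemma exists_boundary_eq_of_no_edge {G : SimpleGraph V} {W : Set V} (hW : W.Nonempty)
    (hG : ∀ u ∈ W, ∀ v ∈ W, ¬ G.Adj u v) {n : ℕ} {x : Finset V →₀ R}
    (hx : x ∈ Finsupp.supported R R (G.indepSetsIn W n)) (hdx : boundary R V x = 0) :
    ∃ y ∈ Finsupp.supported R R (G.indepSetsIn W (n + 1)), boundary R V y = x := by
  obtain ⟨v, hv⟩ := hW
  refine ⟨cone R v x, cone_mem_supported hx fun s hs hvs => ?_, ?_⟩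
  · have hsub : ((insert v s : Finset V) : Set V) ⊆ W := by
      rw [Finset.coe_insert, Set.insert_subset_iff]
      exact ⟨hv, hs.1⟩
    exact ⟨hsub, fun a ha b hb _ => hG a (hsub ha) b (hsub hb),
      by rw [Finset.card_insert_of_notMem hvs, hs.2.2]⟩
  · simpa [hdx] using boundary_cone_add_cone_boundary v x

/-- A chain that fills a cycle of `ind(G)` after the edge `uv` of `G` has been deleted can be
corrected to a filling in `ind(G)`, if all cycles of one dimension less are boundaries in the
independence complex of the non-neighbours of `u` and `v`. -/
lemma exists_boundary_eq_of_deleteEdges {G : SimpleGraph V} {W : Set V} {u v : V} (hu : u ∈ W)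
    (hv : v ∈ W) (huv : G.Adj u v) {n : ℕ}
    (hfill : ∀ z ∈ Finsupp.supported R R
        (G.indepSetsIn {w | w ∈ W ∧ ¬ G.Adj w u ∧ ¬ G.Adj w v} n), boundary R V z = 0 →
      ∃ w ∈ Finsupp.supported R R
        (G.indepSetsIn {w | w ∈ W ∧ ¬ G.Adj w u ∧ ¬ G.Adj w v} (n + 1)), boundary R V w = z)
    {x y : Finset V →₀ R}
    (hx : x ∈ Finsupp.supported R R (G.indepSetsIn W (n + 1)))
    (hy : y ∈ Finsupp.supported R R ((G.deleteEdges {s(u, v)}).indepSetsIn W (n + 2)))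
    (hxy : boundary R V y = x) :
    ∃ y' ∈ Finsupp.supported R R (G.indepSetsIn W (n + 2)), boundary R V y' = x := by
  have hne := huv.ne
  -- No face of `x` contains both ends of the edge `uv`.
  have hxzero : contract R v (contract R u x) = 0 := by
    have h1 : contract R u x ∈ Finsupp.supported R R {s : Finset V | v ∉ s} :=
      contract_mem_supported hx fun s hs hus hvs =>
        hs.2.1 hus (Finset.mem_of_mem_erase hvs) hne huv
    have h2 : contract R v (contract R u x) ∈ Finsupp.supported R R (∅ : Set (Finset V)) :=
      contract_mem_supported h1 fun s hs hvs => (hs hvs).elim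
    simpa using h2
  have hz : contract R v (contract R u y) ∈ Finsupp.supported R R
      (G.indepSetsIn {w | w ∈ W ∧ ¬ G.Adj w u ∧ ¬ G.Adj w v} n) := by
    have h1 : contract R u y ∈ Finsupp.supported R R {t : Finset V | u ∉ t ∧
        insert u t ∈ (G.deleteEdges {s(u, v)}).indepSetsIn W (n + 2)} :=
      contract_mem_supported hy fun s hs hus =>
        ⟨Finset.notMem_erase u s, by rwa [Finset.insert_erase hus]⟩
    refine contract_mem_supported h1 fun s hs hvs => ?_
    obtain ⟨hus, hsub, hind, hcard⟩ := hs
    have hnot : ∀ w ∈ s.erase v, ¬ G.Adj w u ∧ ¬ G.Adj w v := by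
      intro w hw
      obtain ⟨hwv, hws⟩ := Finset.mem_erase.1 hw
      have hwu : w ≠ u := fun h => hus (h ▸ hws)
      refine ⟨fun h => ?_, fun h => ?_⟩
      · refine hind (by simp [hws]) (by simp) hwu ?_
        simp [h, hwv, hwu]
      · refine hind (by simp [hws]) (by simp [hvs]) hwv ?_
        simp [h, hwv, hwu]
    refine ⟨fun w hw => ⟨hsub (by simp [Finset.mem_of_mem_erase hw]), hnot w hw⟩, ?_, ?_⟩
    · refine IsIndepSet.of_deleteEdges (u := u) (v := v)
        (Set.Pairwise.mono (fun w hw => ?_) hind) (fun h => ?_)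
      · exact Finset.mem_insert_of_mem (Finset.mem_of_mem_erase hw)
      · exact Finset.notMem_erase v s h.2
    · rw [Finset.card_insert_of_notMem hus] at hcard
      rw [Finset.card_erase_of_mem hvs]
      omega
  -- Two sign changes cancel: `∂` of the double contraction of `y` is the double contraction of `∂y
  -- = x`, which vanishes.
  obtain ⟨w, hw, hwz⟩ := hfill _ hz <| by
    have h1 := contract_boundary v (contract R u y)
    have h2 := contract_boundary u y
    rw [← neg_eq_iff_eq_neg] at h1 h2
    rw [← h1, ← h2, hxy, map_neg, hxzero, neg_zero, neg_zero]
  -- As `u` and `v` are adjacent, neither is among the common non-neighbours.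
  have hwu : w ∈ Finsupp.supported R R {s : Finset V | u ∉ s ∧ v ∉ s} :=
    mem_supported_of_forall_mem hw fun s hs =>
      ⟨fun h => (hs.1 h).2.2 huv, fun h => (hs.1 h).2.1 huv.symm⟩
  have hcw : contract R v (contract R u (cone R u (cone R v w))) = w := by
    rw [contract_cone_of_supported, contract_cone_of_supported]
    · exact mem_supported_of_forall_mem hwu fun s hs => hs.2
    · exact cone_mem_supported hwu fun s hs _ h => by
        rcases Finset.mem_insert.1 h with h | h
        · exact hne h
        · exact hs.1 h
  have hmem : cone R u (cone R v w) ∈ Finsupp.supported R R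
      ((G.deleteEdges {s(u, v)}).indepSetsIn W (n + 3)) := by
    have h1 : cone R v w ∈ Finsupp.supported R R {t : Finset V | ∃ s, v ∉ s ∧ t = insert v s ∧
        s ∈ G.indepSetsIn {w | w ∈ W ∧ ¬ G.Adj w u ∧ ¬ G.Adj w v} (n + 1)} :=
      cone_mem_supported hw fun s hs hvs => ⟨s, hvs, rfl, hs⟩
    refine cone_mem_supported h1 fun t ht hut => ?_
    obtain ⟨s, hvs, rfl, hsub, hind, hcard⟩ := ht
    refine ⟨?_, ?_, ?_⟩
    · rw [Finset.coe_insert, Finset.coe_insert, Set.insert_subset_iff, Set.insert_subset_iff]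
      exact ⟨hu, hv, fun a ha => (hsub ha).1⟩
    · intro a ha b hb hab hadj
      rw [deleteEdges_adj, Set.mem_singleton_iff] at hadj
      obtain ⟨hadj, hnot⟩ := hadj
      simp only [Finset.coe_insert, Set.mem_insert_iff] at ha hb
      rcases ha with rfl | rfl | ha <;> rcases hb with rfl | rfl | hb
      · exact hab rfl
      · exact hnot rfl
      · exact (hsub hb).2.1 hadj.symm
      · exact hnot Sym2.eq_swap
      · exact hab rfl
      · exact (hsub hb).2.2 hadj.symm
      · exact (hsub ha).2.1 hadj
      · exact (hsub ha).2.2 hadj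
      · exact hind ha hb hab hadj
    · rw [Finset.card_insert_of_notMem hut, Finset.card_insert_of_notMem hvs, hcard]
  have hbd : boundary R V (cone R u (cone R v w)) ∈ Finsupp.supported R R
      ((G.deleteEdges {s(u, v)}).indepSetsIn W (n + 2)) := by
    refine boundary_mem_supported hmem fun s hs a ha => ⟨?_, ?_, ?_⟩
    · exact fun b hb => hs.1 (Finset.mem_of_mem_erase hb)
    · exact Set.Pairwise.mono (fun b hb => Finset.mem_of_mem_erase hb) hs.2.1
    · rw [Finset.card_erase_of_mem ha, hs.2.2]
      omega
  have hy' := Submodule.sub_mem _ hy hbd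
  refine ⟨y - boundary R V (cone R u (cone R v w)), ?_, ?_⟩
  · intro s hs
    have hs' := hy' hs
    refine ⟨hs'.1, IsIndepSet.of_deleteEdges hs'.2.1 fun h => ?_, hs'.2.2⟩
    refine Finsupp.mem_support_iff.1 hs
      (apply_eq_zero_of_contract_contract_eq_zero hne h.1 h.2 ?_)
    rw [map_sub, map_sub, contract_boundary, map_neg, contract_boundary, hcw, hwz, neg_neg,
      sub_self]
  · rw [map_sub, boundary_boundary, sub_zero, hxy]

/-- If `W` is not dominated by `n` edges, then a cycle on independent subsets of `W` with `n`
vertices is a boundary. -/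
theorem exists_boundary_eq_of_not_edgesDominate [Finite V] (n : ℕ) (G : SimpleGraph V) (W : Set V)
    (hdom : ∀ F : Finset (Sym2 V), F.card ≤ n → ¬ G.EdgesDominate F W) (x : Finset V →₀ R)
    (hx : x ∈ Finsupp.supported R R (G.indepSetsIn W n)) (hdx : boundary R V x = 0) :
    ∃ y ∈ Finsupp.supported R R (G.indepSetsIn W (n + 1)), boundary R V y = x := by
  induction n generalizing G W x with
  | zero =>
    have hW : W.Nonempty := by
      by_contra h
      rw [Set.not_nonempty_iff_eq_empty] at h
      exact hdom ∅ le_rfl ⟨by simp, by simp [h]⟩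
    obtain ⟨v, hv⟩ := hW
    refine ⟨cone R v x, cone_mem_supported hx fun s hs hvs => ?_, ?_⟩
    · obtain rfl := Finset.card_eq_zero.1 hs.2.2
      exact ⟨by simpa using hv, by simp [IsIndepSet], by simp⟩
    · simpa [hdx] using boundary_cone_add_cone_boundary v x
  | succ n ih =>
    -- Deleting an edge keeps `n`, so it needs its own induction; passing to non-neighbours keeps
    -- `G` and lowers `n`.
    induction hm : G.edgeSet.ncard using Nat.strong_induction_on generalizing G with
    | _ m ihm =>
    by_cases hG : ∀ u ∈ W, ∀ v ∈ W, ¬ G.Adj u v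
    · have hW : W.Nonempty := by
        by_contra h
        rw [Set.not_nonempty_iff_eq_empty] at h
        exact hdom ∅ (Nat.zero_le _) ⟨by simp, by simp [h]⟩
      exact exists_boundary_eq_of_no_edge hW hG hx hdx
    · push Not at hG
      obtain ⟨u, hu, v, hv, huv⟩ := hG
      have hle : G.deleteEdges {s(u, v)} ≤ G := deleteEdges_le _
      have hlt : (G.deleteEdges {s(u, v)}).edgeSet.ncard < m := by
        rw [← hm, edgeSet_deleteEdges]
        exact Set.ncard_sdiff_singleton_lt_of_mem huv (Set.toFinite _)
      obtain ⟨y, hy, hxy⟩ := ihm _ hlt (G.deleteEdges {s(u, v)})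
        (fun F hF h => hdom F hF (h.mono hle))
        (mem_supported_of_forall_mem hx fun s hs => ⟨hs.1, fun a ha b hb hab h =>
          hs.2.1 ha hb hab (hle h), hs.2.2⟩) rfl
      refine exists_boundary_eq_of_deleteEdges hu hv huv (fun z hz hdz => ?_) hx hy hxy
      exact ih G _ (fun F hF h => hdom _
        ((Finset.card_insert_le _ _).trans (Nat.succ_le_succ hF)) (h.insert huv)) z hz hdz

lemma subsingleton_homology_indComplex [Finite V] (G : SimpleGraph V) (k : ℤ)
    (hdom : ∀ F : Finset (Sym2 V), G.IsEdgewiseDominant F → k + 1 < F.card) :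
    Subsingleton (homology R G.indComplex k) := by
  refine Submodule.Quotient.subsingleton_iff.2 (Submodule.submoduleOf_eq_top.2 ?_)
  rintro x ⟨hx, hdx⟩
  replace hdx : boundary R V x = 0 := hdx
  -- Below dimension `-1` there are no chains; otherwise `n = k + 1` counts the vertices of a face.
  rcases lt_or_ge (k + 1) 0 with hk | hk
  · have h : x = 0 := by
      rw [← Finsupp.support_eq_empty, Finset.eq_empty_iff_forall_notMem]
      intro s hs
      have := (hx hs).2
      omega
    rw [h]
    exact Submodule.zero_mem _
  · obtain ⟨n, hn⟩ := Int.eq_ofNat_of_zero_le hk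
    obtain ⟨y, hy, hxy⟩ := exists_boundary_eq_of_not_edgesDominate n G Set.univ
      (fun F hF h => by
        have := hdom F ⟨h.1, fun v => h.2 v (Set.mem_univ v)⟩
        omega) x
      (mem_supported_of_forall_mem hx fun s hs => by
        refine ⟨Set.subset_univ _, ?_, ?_⟩
        · rcases hs.1 with rfl | h
          · simp [IsIndepSet]
          · exact h.2
        · have := hs.2
          omega) hdx
    refine ⟨y, mem_supported_of_forall_mem hy fun s hs => ⟨?_, ?_⟩, hxy⟩
    · exact s.eq_empty_or_nonempty.imp id fun h => ⟨h, hs.2.1⟩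
    · rw [hs.2.2, hn]
      push_cast
      ring

end LinearOrder

lemma gammaZero_le_two_mul_card {G : SimpleGraph V} {F : Finset (Sym2 V)}
    (hF : G.IsEdgewiseDominant F) : G.gammaZero ≤ ((2 * F.card : ℕ) : ℕ∞) := by
  classical
  refine (iInf₂_le (F.biUnion Sym2.toFinset) fun v _ => ?_).trans ?_
  · obtain ⟨e, he, w, hw, hvw⟩ := hF.2 v
    exact ⟨w, Finset.mem_biUnion.2 ⟨e, he, Sym2.mem_toFinset.2 hw⟩, hvw.symm⟩
  · rw [Nat.cast_le, mul_comm]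
    refine Finset.card_biUnion_le_card_mul _ _ _ fun e _ => ?_
    rw [Sym2.card_toFinset]
    split_ifs <;> omega

end SimpleGraph

end

theorem corollary6p5 {V : Type*} [Finite V] [LinearOrder V] (G : SimpleGraph V)
    (𝕜 : Type*) [Field 𝕜] :
    (∀ k : ℤ, ((k : ℝ) : EReal) < ((G.edgewiseDominationNumber : ℝ≥0∞) : EReal) - 1 →
      Subsingleton (ReducedHomology.homology 𝕜 G.indComplex k)) ∧
    (∀ k : ℤ, ((k : ℝ) : EReal) < ((G.gammaZero : ℝ≥0∞) : EReal) / 2 - 1 →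
      Subsingleton (ReducedHomology.homology 𝕜 G.indComplex k)) := by
  constructor
  · intro k hk
    refine G.subsingleton_homology_indComplex k fun F hF => ?_
    have h1 : G.edgewiseDominationNumber ≤ (F.card : ℕ∞) := iInf₂_le F hF
    generalize G.edgewiseDominationNumber = d at *
    -- The set `F` at hand makes the infimum finite; if no such `F` exists, there is nothing to
    -- check.
    lift d to ℕ using ne_top_of_le_ne_top (ENat.natCast_ne_top _) h1
    have h2 : d ≤ F.card := by exact_mod_cast h1
    have h3 : ((k : ℝ) : EReal) < (((d : ℝ) - 1 : ℝ) : EReal) := by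
      rw [EReal.coe_sub]
      exact hk
    have h4 : (k : ℝ) < (d : ℝ) - 1 := EReal.coe_lt_coe_iff.1 h3
    have h5 : (k : ℝ) + 1 < F.card := by
      have : (d : ℝ) ≤ F.card := by exact_mod_cast h2
      linarith
    exact_mod_cast h5
  · intro k hk
    refine G.subsingleton_homology_indComplex k fun F hF => ?_
    have h1 := SimpleGraph.gammaZero_le_two_mul_card hF
    generalize G.gammaZero = d at *
    lift d to ℕ using ne_top_of_le_ne_top (ENat.natCast_ne_top _) h1
    have h2 : d ≤ 2 * F.card := by exact_mod_cast h1
    have h3 : ((k : ℝ) : EReal) < (((d : ℝ) / 2 - 1 : ℝ) : EReal) := by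
      rw [EReal.coe_sub, EReal.coe_div]
      exact hk
    have h4 : (k : ℝ) < (d : ℝ) / 2 - 1 := EReal.coe_lt_coe_iff.1 h3
    have h5 : (k : ℝ) + 1 < F.card := by
      have : (d : ℝ) ≤ 2 * F.card := by exact_mod_cast h2
      linarith
    exact_mod_cast h5
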